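/- Setting. Let $K:\mathbb R^d\to\mathbb R$ be a bounded, continuous, non-negative kernel with $\int K=1$ that is radially symmetric, $K(u)=k(\|u\|^2/2)$, where the profile $k:[0,\infty)\to\mathbb R$ is convex and non-increasing with finite right derivative $k'(0+)>-\infty$. Let $\partial k(u)=\{c\in\mathbb R : k(v)\ge k(u)+c(v-u)\ \text{for all } v\in[0,\infty)\}$, and let $g:[0,\infty)\to\mathbb R$ be any function with $g(0)=-k'(0+)$ and $g(u)\in-\partial k(u)$ for $u>0$; put $G(u)=g(\|u\|^2/2)$. Fix a bandwidth $h>0$ and data $x=(x_1,\dots,x_n)$, $x_i\in\mathbb R^d$. The blurring mean shift (BMS) sequence of configurations $y_t=(y_{t,1},\dots,y_{t,n})\in\mathbb R^{nd}$ is given by $y_0=x$ and $$y_{t+1,i}=\frac{\sum_{j=1}^n G\bigl(\tfrac{y_{t,i}-y_{t,j}}h\bigr)\,y_{t,j}}{\sum_{j=1}^n G\bigl(\tfrac{y_{t,i}-y_{t,j}}h\bigr)},\qquad i=1,\dots,n,\ t=0,1,2,\dots$$ For a configuration $u$, let $L(u)=\sum_{i,j=1}^nK\bigl(\tfrac{u_i-u_j}h\bigr)$,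 and let the BMS graph $\mathcal G_u$ be the simple graph on $\{1,\dots,n\}$ in which $i\ne j$ are joined iff $G\bigl(\tfrac{u_i-u_j}h\bigr)\neq0$. A graph is closed if all of its connected components are complete. Let $\beta=\sup\{u\ge0 : k(u^2/2)\ne0\}\in(0,\infty]$. The kernel is non-smoothly truncated if $\beta<\infty$ and $u\mapsto k(u^2/2)$ is not differentiable at $u=\beta$. Norms are Euclidean, and $O$ refers to $t\to\infty$. Theorem. Suppose that the kernel is non-smoothly truncated. Then the limit $\bar y=\lim_{t\to\infty}y_t$ exists, and there is $\tau\in\mathbb N$ such that the graphs $\mathcal G_{y_t}$, $t\ge\tau$, are all one and the same closed graph; this graph equals $\mathcal G_{\bar y}$ if $g(\beta^2/2)=0$ or if $\|\bar y_i-\bar y_j\|\ne\beta h$ for all $i,j$. Let $\mathcal V_1,\dots,\mathcal V_M$ be the vertex sets of the connected components of $\mathcal G_{y_\tau}$. There are $M$ pairwise different points $z_1,\dots,z_M\in\mathbb R^d$ such that: 1. (Exponential rate.) There is $q\in[\frac34,1)$ with $\|y_t-\bar y\|=O(q^t)$, $\|y_{t,i}-z_m\|=O(q^t)$ for all $m$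 and all $i\in\mathcal V_m$, and $L(\bar y)-L(y_t)=O(q^{2t})$. 2. (Cubic rate.) If in addition, for some $v>0$, the profile $k$ is differentiable with a Lipschitz-continuous derivative on $(0,v]$, then there are $\tau'\in\mathbb N$, $p\in(0,\infty)$ and $q\in(0,1)$ with $\|y_{t+1}-\bar y\|\le p\,\|y_t-\bar y\|^3$ for all $t\ge\tau'$, $\|y_t-\bar y\|=O(q^{3^t})$, $\|y_{t,i}-z_m\|=O(q^{3^t})$ for all $m$ and all $i\in\mathcal V_m$, and $L(\bar y)-L(y_t)=O(q^{2\cdot3^t})$. -/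

import Mathlib

open Set Filter Topology MeasureTheory Asymptotics
open scoped ENNReal NNReal

/-- The standing assumptions on the kernel `K` on `ℝ^d` and its profile `k : [0, ∞) → ℝ`.
Only the values of `k` on `[0, ∞)` matter. -/
structure IsKernelWithProfile {d : ℕ} (K : EuclideanSpace ℝ (Fin d) → ℝ) (k : ℝ → ℝ) :
    Prop where
  bounded : ∃ C : ℝ, ∀ u, |K u| ≤ C
  continuous : Continuous K
  nonneg : ∀ u, 0 ≤ K u
  integrable : Integrable K
  normalized : ∫ u, K u = 1
  radial : ∀ u, K u = k (‖u‖ ^ 2 / 2)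
  convex : ConvexOn ℝ (Ici 0) k
  nonincreasing : AntitoneOn k (Ici 0)
  /-- the right derivative of `k` at `0` is finite -/
  rightDeriv_finite : ∃ c : ℝ, HasDerivWithinAt k c (Ici 0) 0

/-- The subdifferential at `u` of a convex function `k` on `[0, ∞)`. -/
def profileSubdifferential (k : ℝ → ℝ) (u : ℝ) : Set ℝ :=
  {c | ∀ v ∈ Ici (0 : ℝ), k u + c * (v - u) ≤ k v}

/-- `g` is an admissible weight profile for `k`: `g 0 = -k'(0+)`, and `-g u` is some element of
the subdifferential of `k` at `u` for each `u > 0`. -/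
structure IsWeightProfile (k g : ℝ → ℝ) : Prop where
  zero : HasDerivWithinAt k (-g 0) (Ici 0) 0
  pos : ∀ u : ℝ, 0 < u → -g u ∈ profileSubdifferential k u

/-- The truncation point `β = sup {u ≥ 0 | k (u² / 2) ≠ 0} ∈ [0, ∞]`. -/
noncomputable def truncationPoint (k : ℝ → ℝ) : ℝ≥0∞ :=
  sSup (ENNReal.ofReal '' {u : ℝ | 0 ≤ u ∧ k (u ^ 2 / 2) ≠ 0})

/-- The kernel with profile `k` is truncated, non-smoothly. -/
def IsNonSmoothlyTruncated (k : ℝ → ℝ) : Prop :=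
  truncationPoint k < ⊤ ∧
    ¬ DifferentiableAt ℝ (fun u : ℝ => k (u ^ 2 / 2)) (truncationPoint k).toReal

/-- The profile is differentiable with a Lipschitz-continuous derivative on some `(0, v]`. -/
def HasLipschitzDerivNearZero (k : ℝ → ℝ) : Prop :=
  ∃ v : ℝ, 0 < v ∧ (∀ u ∈ Ioc 0 v, DifferentiableAt ℝ k u) ∧
    ∃ C : ℝ≥0, LipschitzOnWith C (deriv k) (Ioc 0 v)

/-- Configurations of `n` points of `ℝ^d`, with the Euclidean norm of `ℝ^{nd}`. -/
abbrev Configuration (n d : ℕ) : Type :=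
  PiLp 2 (fun _ : Fin n => EuclideanSpace ℝ (Fin d))

/-- The weight `G ((a - b) / h)`, where `G u = g (‖u‖² / 2)`. -/
noncomputable def bmsWeight {d : ℕ} (g : ℝ → ℝ) (h : ℝ) (a b : EuclideanSpace ℝ (Fin d)) : ℝ :=
  g (‖h⁻¹ • (a - b)‖ ^ 2 / 2)

/-- One blurring mean shift update of a configuration. -/
noncomputable def bmsStep {n d : ℕ} (g : ℝ → ℝ) (h : ℝ) (y : Configuration n d) :
    Configuration n d :=
  WithLp.toLp 2 fun i =>
    (∑ j, bmsWeight g h (y i) (y j))⁻¹ • ∑ j, bmsWeight g h (y i) (y j) • y j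

/-- The configuration obtained from the data `x` after `t` blurring mean shift updates. -/
noncomputable def bmsSequence {n d : ℕ} (g : ℝ → ℝ) (h : ℝ) (x : Configuration n d) (t : ℕ) :
    Configuration n d :=
  (bmsStep g h)^[t] x

/-- The BMS graph of a configuration: distinct `i`, `j` are joined iff
`G ((u_i - u_j) / h) ≠ 0`. -/
def bmsGraph {n d : ℕ} (g : ℝ → ℝ) (h : ℝ) (u : Configuration n d) : SimpleGraph (Fin n) where
  Adj i j := i ≠ j ∧ bmsWeight g h (u i) (u j) ≠ 0
  symm := ⟨fun i j hij => ⟨hij.1.symm, by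
    have e : bmsWeight g h (u j) (u i) = bmsWeight g h (u i) (u j) := by
      unfold bmsWeight
      rw [norm_smul, norm_smul, norm_sub_rev]
    rw [e]
    exact hij.2⟩⟩
  loopless := ⟨fun _ hi => hi.1 rfl⟩

/-- A graph is closed if all of its connected components are complete. -/
def IsClosedGraph {V : Type*} (𝒢 : SimpleGraph V) : Prop :=
  ∀ c : 𝒢.ConnectedComponent, 𝒢.IsClique c.supp

/-- The objective function `L u = ∑ i j, K ((u_i - u_j) / h)`. -/
noncomputable def bmsObjective {n d : ℕ} (K : EuclideanSpace ℝ (Fin d) → ℝ) (h : ℝ)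
    (u : Configuration n d) : ℝ :=
  ∑ i, ∑ j, K (h⁻¹ • (u i - u j))

/-! Non-smooth truncation forces `g` to be bounded below by some `c > 0` before the truncation point
(`IsWeightProfile.exists_pos_le`), so after adjusting `c` at the critical distance `ρ = βh`, a
weight is either zero or at least `c`.

Convexity makes the objective increase by at least a multiple of the squared step
(`bmsObjective_ascent`). Since it is bounded, the steps tend to zero. The weighted energy `∑ w ‖y i
- y j‖²` is controlled by the steps, so it vanishes too, and the lower bound `c` pulls interacting
points together (`eventually_near_of_ne_zero`). Non-interacting points stay at distance at least
`ρ`. Small steps cannot cross this gap, so the graph freezes, and the triangle inequality makes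
interaction an equivalence relation (`exists_equivalence`).

Inside a class all weights are then close to `g 0`, so every point moves close to the plain mean of
its class. The spread contracts by a factor proportional to the defect of the weights from `g 0`
(`relatedSpread_step_le`). A small constant defect gives halving, hence convergence at an
exponential rate. If `k'` is Lipschitz near zero, the defect is of the order of the squared spread,
and the contraction is cubic. The objective error is quadratic in the distance to the limit, which
doubles the exponents. -/

/-! ### Convex analysis of the profile and its subgradients. -/

section Profile

variable {k g : ℝ → ℝ}

/-- The subgradient inequality, also at `0`. -/
theorem IsWeightProfile.subgradient_le (hg : IsWeightProfile k g) (hk : ConvexOn ℝ (Ici 0) k)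
    {u v : ℝ} (hu : 0 ≤ u) (hv : 0 ≤ v) : k u - g u * (v - u) ≤ k v := by
  rcases hu.eq_or_lt with rfl | hu
  · rcases hv.eq_or_lt with rfl | hv
    · simp
    · have h := hk.le_slope_of_hasDerivWithinAt (mem_Ici.2 le_rfl) (mem_Ici.2 hv.le) hv hg.zero
      rw [slope_def_field, le_div_iff₀ (by linarith)] at h
      linarith
  · have := hg.pos u hu v hv
    linarith

theorem IsWeightProfile.antitoneOn (hg : IsWeightProfile k g) (hk : ConvexOn ℝ (Ici 0) k) :
    AntitoneOn g (Ici 0) := by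
  intro u hu v hv huv
  rcases huv.eq_or_lt with rfl | huv
  · rfl
  have h₁ := hg.subgradient_le hk hu hv
  have h₂ := hg.subgradient_le hk hv hu
  by_contra! h
  nlinarith [mul_pos (sub_pos.2 h) (sub_pos.2 huv)]

theorem IsWeightProfile.nonneg (hg : IsWeightProfile k g) (hk : ConvexOn ℝ (Ici 0) k)
    (hk' : AntitoneOn k (Ici 0)) {u : ℝ} (hu : 0 ≤ u) : 0 ≤ g u := by
  have h₁ := hg.subgradient_le hk hu (by linarith : 0 ≤ u + 1)
  have h₂ := hk' (mem_Ici.2 hu) (mem_Ici.2 (by linarith : 0 ≤ u + 1)) (by linarith)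
  linarith

/-- Some chord of `k` from `0` to `v` has slope close to `-g 0`. For `u` small against `v`, the
supporting lines at `0` and `u` leave no room for `g u` to fall much below `g 0`. -/
theorem IsWeightProfile.eventually_near_zero (hg : IsWeightProfile k g)
    (hk : ConvexOn ℝ (Ici 0) k) (hg0 : 0 < g 0) {ε : ℝ} (hε : 0 < ε) :
    ∃ δ > 0, ∀ u, 0 ≤ u → u ≤ δ → g 0 - ε ≤ g u := by
  obtain ⟨v, hv, hkv⟩ : ∃ v > 0, k v ≤ k 0 - (g 0 - ε / 2) * v := by
    have h := hg.zero.Ioi_of_Ici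
    rw [hasDerivWithinAt_iff_tendsto_slope' (by simp)] at h
    have h' := h.eventually (gt_mem_nhds (by linarith : -g 0 < -g 0 + ε / 2))
    obtain ⟨v, hv, hv0⟩ := (h'.and self_mem_nhdsWithin).exists
    replace hv0 : 0 < v := hv0
    rw [slope_def_field, div_lt_iff₀ (by linarith)] at hv
    exact ⟨v, hv0, by linarith⟩
  refine ⟨min (v / 2) (ε * v / (2 * g 0)), by positivity, fun u hu huδ => ?_⟩
  have h₁ : u ≤ v / 2 := huδ.trans (min_le_left _ _)
  have h₂ : u ≤ ε * v / (2 * g 0) := huδ.trans (min_le_right _ _)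
  rw [le_div_iff₀ (by linarith)] at h₂
  have h₃ := hg.subgradient_le hk hu hv.le
  have h₄ := hg.subgradient_le hk le_rfl hu
  by_contra! h
  have h₅ : (g 0 - ε - g u) * (v - u) > 0 := mul_pos (by linarith) (by linarith)
  nlinarith [mul_nonneg hε.le hu]

theorem IsWeightProfile.deriv_eq (hg : IsWeightProfile k g) {u : ℝ} (hu : 0 < u)
    (hd : DifferentiableAt ℝ k u) : deriv k u = -g u := by
  have hmin : IsLocalMin (fun v => k v - (-g u) * (v - u)) u := by
    filter_upwards [Ioi_mem_nhds hu] with v hv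
    have := hg.pos u hu v (mem_Ici.2 (le_of_lt hv))
    simp only [sub_self, mul_zero, sub_zero]
    linarith
  have hder : HasDerivAt (fun v => k v - (-g u) * (v - u)) (deriv k u - (-g u) * 1) u :=
    hd.hasDerivAt.sub (((hasDerivAt_id u).sub_const u).const_mul _)
  have := hmin.hasDerivAt_eq_zero hder
  linarith

theorem IsWeightProfile.lipschitz_at_zero (hg : IsWeightProfile k g)
    (hk : ConvexOn ℝ (Ici 0) k) (hk' : AntitoneOn k (Ici 0)) (hg0 : 0 < g 0)
    (hl : HasLipschitzDerivNearZero k) :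
    ∃ C > 0, ∀ u, 0 ≤ u → g 0 - g u ≤ C * u := by
  obtain ⟨v, hv, hd, C, hC⟩ := hl
  -- The term `C` serves `u ≤ v`; the term `g 0 / v` makes the bound trivial beyond `v`.
  refine ⟨C + g 0 / v, by positivity, fun u hu => ?_⟩
  have hCu : 0 ≤ C * u := by positivity
  have hvu : 0 ≤ g 0 / v * u := by positivity
  rw [add_mul]
  rcases hu.eq_or_lt with rfl | hu0
  · simp
  rcases le_or_gt u v with huv | huv
  · suffices g 0 - g u ≤ C * u by linarith
    -- The Lipschitz bound excludes the endpoint `0`, which is replaced by the nearby point `min δ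
    -- u` at the cost of `ε`.
    refine le_of_forall_pos_le_add fun ε hε => ?_
    obtain ⟨δ, hδ, hδε⟩ := hg.eventually_near_zero hk hg0 hε
    have hm : 0 < min δ u := lt_min hδ hu0
    have h₁ := hδε _ hm.le (min_le_left _ _)
    have h₂ := hC.dist_le_mul (min δ u) ⟨hm, (min_le_right _ _).trans huv⟩ u ⟨hu0, huv⟩
    rw [hg.deriv_eq hm (hd _ ⟨hm, (min_le_right _ _).trans huv⟩), hg.deriv_eq hu0 (hd _ ⟨hu0, huv⟩),
      Real.dist_eq, Real.dist_eq, abs_sub_comm (min δ u), abs_of_nonneg (by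
        linarith [min_le_right δ u] : 0 ≤ u - min δ u)] at h₂
    have h₃ := neg_abs_le (-g (min δ u) - -g u)
    have h₄ : C * (u - min δ u) ≤ C * u :=
      mul_le_mul_of_nonneg_left (by linarith) C.coe_nonneg
    linarith
  · have : g 0 ≤ g 0 / v * u := by
      rw [div_mul_eq_mul_div, le_div_iff₀ hv]
      exact mul_le_mul_of_nonneg_left huv.le hg0.le
    linarith [hg.nonneg hk hk' hu]

theorem eq_zero_of_truncationPoint_lt (ht : truncationPoint k < ⊤) {u : ℝ}
    (hu : (truncationPoint k).toReal ^ 2 / 2 < u) : k u = 0 := by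
  have hu0 : 0 ≤ u := le_trans (by positivity) hu.le
  by_contra hne
  have hmem : ENNReal.ofReal (√(2 * u)) ≤ truncationPoint k := by
    refine le_sSup ⟨√(2 * u), ⟨Real.sqrt_nonneg _, ?_⟩, rfl⟩
    rw [Real.sq_sqrt (by linarith)]
    simpa using hne
  have h := ENNReal.toReal_mono ht.ne hmem
  rw [ENNReal.toReal_ofReal (Real.sqrt_nonneg _), Real.sqrt_le_left ENNReal.toReal_nonneg] at h
  linarith

/-- At the truncation point itself, the finite subgradient prevents a jump: `k u ≤ s * g u` for
every `s > 0`. -/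
theorem IsWeightProfile.eq_zero_of_truncationPoint_le (hg : IsWeightProfile k g)
    (hk : ConvexOn ℝ (Ici 0) k) (hk' : AntitoneOn k (Ici 0)) (ht : truncationPoint k < ⊤) {u : ℝ}
    (hu : (truncationPoint k).toReal ^ 2 / 2 ≤ u) : k u = 0 := by
  have hu0 : 0 ≤ u := le_trans (by positivity) hu
  have hz : ∀ v, u < v → k v = 0 := fun v hv =>
    eq_zero_of_truncationPoint_lt ht (hu.trans_lt hv)
  refine le_antisymm (le_of_forall_pos_le_add fun ε hε => ?_) ?_
  · have hgu := hg.nonneg hk hk' hu0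
    have hpos : 0 < ε / (g u + 1) := by positivity
    have h := hg.subgradient_le hk hu0 (by linarith : 0 ≤ u + ε / (g u + 1))
    rw [hz (u + _) (by linarith), add_sub_cancel_left] at h
    have : g u * (ε / (g u + 1)) ≤ ε := by
      rw [mul_div_assoc', div_le_iff₀ (by linarith)]
      nlinarith
    linarith
  · rw [← hz (u + 1) (by linarith)]
    exact hk' (mem_Ici.2 hu0) (mem_Ici.2 (by linarith)) (by linarith)

theorem IsWeightProfile.weight_eq_zero (hg : IsWeightProfile k g)
    (hk : ConvexOn ℝ (Ici 0) k) (hk' : AntitoneOn k (Ici 0)) (ht : truncationPoint k < ⊤) {u : ℝ}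
    (hu : (truncationPoint k).toReal ^ 2 / 2 < u) : g u = 0 := by
  have hb : 0 ≤ (truncationPoint k).toReal ^ 2 / 2 := by positivity
  have h := hg.subgradient_le hk (hb.trans hu.le) hb
  rw [hg.eq_zero_of_truncationPoint_le hk hk' ht hu.le,
    hg.eq_zero_of_truncationPoint_le hk hk' ht le_rfl] at h
  have := hg.nonneg hk hk' (hb.trans hu.le)
  by_contra hne
  have := mul_pos (lt_of_le_of_ne this (Ne.symm hne)) (sub_pos.2 hu)
  linarith

theorem truncationPoint_toReal_pos {d : ℕ} {K : EuclideanSpace ℝ (Fin d) → ℝ}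
    (hK : IsKernelWithProfile K k) (hg : IsWeightProfile k g) (ht : truncationPoint k < ⊤) :
    0 < (truncationPoint k).toReal := by
  refine lt_of_le_of_ne ENNReal.toReal_nonneg fun h0 => ?_
  have hz : ∀ u, 0 ≤ u → k u = 0 := fun u hu =>
    hg.eq_zero_of_truncationPoint_le hK.convex hK.nonincreasing ht (by rw [← h0]; simpa using hu)
  have hK0 : K = fun _ => 0 := by
    ext u
    rw [hK.radial, hz _ (by positivity)]
  have := hK.normalized
  simp [hK0] at this

/-- The only place where non-smoothness enters. If `g` took arbitrarily small values before `b = B ^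
2 / 2`, monotonicity would give `0 ≤ k v ≤ ε * (b - v)` just before `b`, so `k` would have
derivative `0` there and the truncation would be smooth. -/
theorem IsWeightProfile.exists_pos_le (hg : IsWeightProfile k g)
    (hk : ConvexOn ℝ (Ici 0) k) (hk' : AntitoneOn k (Ici 0)) (ht : IsNonSmoothlyTruncated k) :
    ∃ c > 0, ∀ u, 0 ≤ u → u < (truncationPoint k).toReal ^ 2 / 2 → c ≤ g u := by
  by_contra! hc
  set B := (truncationPoint k).toReal with hB
  refine ht.2 ?_
  have hkb : k (B ^ 2 / 2) = 0 := hg.eq_zero_of_truncationPoint_le hk hk' ht.1 le_rfl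
  suffices h : HasDerivAt k 0 (B ^ 2 / 2) by
    have hsq : DifferentiableAt ℝ (fun u : ℝ => u ^ 2 / 2) B := by fun_prop
    exact DifferentiableAt.comp B (g := k) h.differentiableAt hsq
  rw [hasDerivAt_iff_isLittleO, Asymptotics.isLittleO_iff]
  intro ε hε
  obtain ⟨u, hu0, hub, hgu⟩ := hc ε hε
  filter_upwards [Ioi_mem_nhds hub] with v hv
  rw [mem_Ioi] at hv
  have hv0 : 0 ≤ v := hu0.trans hv.le
  simp only [hkb, smul_zero, sub_zero]
  rcases le_or_gt (B ^ 2 / 2) v with h | h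
  · rw [hg.eq_zero_of_truncationPoint_le hk hk' ht.1 h, norm_zero]
    positivity
  · have h₁ : 0 ≤ k v := hkb ▸ hk' (mem_Ici.2 hv0) (mem_Ici.2 (hv0.trans h.le)) h.le
    have h₂ := hg.subgradient_le hk hv0 (hv0.trans h.le)
    have h₃ := hg.antitoneOn hk (mem_Ici.2 hu0) (mem_Ici.2 hv0) hv.le
    rw [Real.norm_of_nonneg h₁, Real.norm_eq_abs, abs_sub_comm, abs_of_pos (sub_pos.2 h)]
    have := mul_le_mul_of_nonneg_right (h₃.trans hgu.le) (sub_pos.2 h).le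
    linarith

end Profile

/-- A symmetric weight `w ≤ w x x = a` that vanishes at distances above `ρ`, is bounded below by `c`
on its support and at distances below `ρ`, and is continuous on the diagonal. -/
structure IsTruncatedWeight {E : Type*} [NormedAddCommGroup E] (w : E → E → ℝ) (a ρ c : ℝ) :
    Prop where
  pos : 0 < a
  radius_pos : 0 < ρ
  lower_pos : 0 < c
  comm : ∀ x y, w x y = w y x
  nonneg : ∀ x y, 0 ≤ w x y
  le : ∀ x y, w x y ≤ a
  self : ∀ x, w x x = a
  eq_zero : ∀ x y, ρ < ‖x - y‖ → w x y = 0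
  lower_of_lt : ∀ x y, ‖x - y‖ < ρ → c ≤ w x y
  lower_of_ne : ∀ x y, w x y ≠ 0 → c ≤ w x y
  near_diagonal : ∀ ε > 0, ∃ δ > 0, ∀ x y, ‖x - y‖ ≤ δ → a - ε ≤ w x y

/-! ### From the profile to the weight on pairs of points. -/

section Kernel

variable {d : ℕ} {K : EuclideanSpace ℝ (Fin d) → ℝ} {k g : ℝ → ℝ} {h : ℝ}

theorem norm_inv_smul_sq (hh : 0 < h) (x : EuclideanSpace ℝ (Fin d)) :
    ‖h⁻¹ • x‖ ^ 2 / 2 = ‖x‖ ^ 2 / (2 * h ^ 2) := by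
  rw [norm_smul, norm_inv, Real.norm_of_nonneg hh.le]
  field_simp

theorem bmsWeight_eq (hh : 0 < h) (x y : EuclideanSpace ℝ (Fin d)) :
    bmsWeight g h x y = g (‖x - y‖ ^ 2 / (2 * h ^ 2)) := by
  rw [bmsWeight, norm_inv_smul_sq hh]

theorem exists_isTruncatedWeight (hK : IsKernelWithProfile K k) (hg : IsWeightProfile k g)
    (ht : IsNonSmoothlyTruncated k) (hh : 0 < h) :
    ∃ c, IsTruncatedWeight (bmsWeight (d := d) g h) (g 0) ((truncationPoint k).toReal * h) c := by
  have hb := truncationPoint_toReal_pos hK hg ht.1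
  obtain ⟨c, hc, hcg⟩ := hg.exists_pos_le hK.convex hK.nonincreasing ht
  have hn := fun u hu => hg.nonneg (u := u) hK.convex hK.nonincreasing hu
  have hz := fun u hu => hg.weight_eq_zero (u := u) hK.convex hK.nonincreasing ht.1 hu
  have hanti := hg.antitoneOn hK.convex
  set B := (truncationPoint k).toReal
  have hg0 : 0 < g 0 := hc.trans_le (hcg 0 le_rfl (by positivity))
  -- At the critical distance `g` may take any value of a subdifferential, possibly a nonzero one
  -- below `c`; the constant is lowered to cover it.
  obtain ⟨c', hc', hcc', hc'g⟩ : ∃ c' > 0, c' ≤ c ∧ (g (B ^ 2 / 2) ≠ 0 → c' ≤ g (B ^ 2 / 2)) := by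
    rcases (hn (B ^ 2 / 2) (by positivity)).eq_or_lt with h0 | h0
    · exact ⟨c, hc, le_rfl, fun h => absurd h0.symm h⟩
    · exact ⟨min c (g (B ^ 2 / 2)), lt_min hc h0, min_le_left _ _, fun _ => min_le_right _ _⟩
  have hlt : ∀ x : EuclideanSpace ℝ (Fin d), ‖x‖ < B * h → ‖x‖ ^ 2 / (2 * h ^ 2) < B ^ 2 / 2 := by
    intro x hx
    rw [div_lt_div_iff₀ (by positivity) (by norm_num)]
    nlinarith [pow_lt_pow_left₀ hx (norm_nonneg x) two_ne_zero]
  have hgt : ∀ x : EuclideanSpace ℝ (Fin d), B * h < ‖x‖ → B ^ 2 / 2 < ‖x‖ ^ 2 / (2 * h ^ 2) := by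
    intro x hx
    rw [div_lt_div_iff₀ (by norm_num) (by positivity)]
    nlinarith [pow_lt_pow_left₀ hx (by positivity) two_ne_zero]
  have hlower : ∀ x y : EuclideanSpace ℝ (Fin d), ‖x - y‖ < B * h → c' ≤ bmsWeight g h x y := by
    intro x y hxy
    rw [bmsWeight_eq hh]
    exact hcc'.trans (hcg _ (by positivity) (hlt _ hxy))
  have hzero : ∀ x y : EuclideanSpace ℝ (Fin d), B * h < ‖x - y‖ → bmsWeight g h x y = 0 := by
    intro x y hxy
    rw [bmsWeight_eq hh]
    exact hz _ (hgt _ hxy)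
  refine ⟨c', hg0, by positivity, hc', ?_, ?_, ?_, ?_, hzero, hlower, ?_, ?_⟩
  · intro x y
    rw [bmsWeight_eq hh, bmsWeight_eq hh, norm_sub_rev]
  · intro x y
    rw [bmsWeight_eq hh]
    exact hn _ (by positivity)
  · intro x y
    rw [bmsWeight_eq hh]
    have : 0 ≤ ‖x - y‖ ^ 2 / (2 * h ^ 2) := by positivity
    exact hanti (mem_Ici.2 le_rfl) (mem_Ici.2 this) this
  · intro x
    simp [bmsWeight]
  · intro x y hxy
    rcases lt_trichotomy ‖x - y‖ (B * h) with hlt' | heq | hgt'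
    · exact hlower x y hlt'
    · rw [bmsWeight_eq hh, heq] at hxy ⊢
      have e : (B * h) ^ 2 / (2 * h ^ 2) = B ^ 2 / 2 := by field_simp
      rw [e] at hxy ⊢
      exact hc'g hxy
    · exact absurd (hzero x y hgt') hxy
  · intro ε hε
    obtain ⟨δ, hδ, hδg⟩ := hg.eventually_near_zero hK.convex hg0 hε
    refine ⟨√(δ * (2 * h ^ 2)), by positivity, fun x y hxy => ?_⟩
    rw [bmsWeight_eq hh]
    refine hδg _ (by positivity) ?_
    rw [div_le_iff₀ (by positivity)]
    exact (Real.le_sqrt (norm_nonneg _) (by positivity)).1 hxy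

theorem exists_sub_bmsWeight_le (hK : IsKernelWithProfile K k) (hg : IsWeightProfile k g)
    (hh : 0 < h) (hg0 : 0 < g 0) (hl : HasLipschitzDerivNearZero k) :
    ∃ C > 0, ∀ x y : EuclideanSpace ℝ (Fin d), g 0 - C * ‖x - y‖ ^ 2 ≤ bmsWeight g h x y := by
  obtain ⟨C, hC, hCg⟩ := hg.lipschitz_at_zero hK.convex hK.nonincreasing hg0 hl
  refine ⟨C / (2 * h ^ 2), by positivity, fun x y => ?_⟩
  have := hCg (‖x - y‖ ^ 2 / (2 * h ^ 2)) (by positivity)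
  rw [bmsWeight_eq hh]
  have e : C / (2 * h ^ 2) * ‖x - y‖ ^ 2 = C * (‖x - y‖ ^ 2 / (2 * h ^ 2)) := by ring
  linarith

theorem kernel_eq (hK : IsKernelWithProfile K k) (hh : 0 < h) (x : EuclideanSpace ℝ (Fin d)) :
    K (h⁻¹ • x) = k (‖x‖ ^ 2 / (2 * h ^ 2)) := by
  rw [hK.radial, norm_inv_smul_sq hh]

end Kernel

/-! ### Weighted means and summation by parts. -/

section Mean

variable {ι E : Type*} [NormedAddCommGroup E] [InnerProductSpace ℝ E]

theorem norm_centerMass_sub_le {S : Finset ι} {w : ι → ℝ} {y : ι → E} {x : E} {r : ℝ}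
    (hw : ∀ j ∈ S, 0 ≤ w j) (hpos : 0 < ∑ j ∈ S, w j) (hy : ∀ j ∈ S, ‖y j - x‖ ≤ r) :
    ‖S.centerMass w y - x‖ ≤ r := by
  have := (convex_closedBall x r).centerMass_mem hw hpos (z := y)
    (fun j hj => by simpa [dist_eq_norm] using hy j hj)
  simpa [dist_eq_norm] using this

/-- A weighted mean with nearly equal weights is close to the mean. -/
theorem norm_centerMass_sub_mean_le {S : Finset ι} (hS : S.Nonempty) {w : ι → ℝ} {y : ι → E}
    {a ε r : ℝ} (ha : 0 < a) (hε : ε ≤ a / 2) (hw : ∀ j ∈ S, a - ε ≤ w j)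
    (hw' : ∀ j ∈ S, w j ≤ a) (hy : ∀ i ∈ S, ∀ j ∈ S, ‖y i - y j‖ ≤ r) :
    ‖S.centerMass w y - S.centerMass (fun _ => (1 : ℝ)) y‖ ≤ 2 * ε / a * r := by
  set m := S.centerMass (fun _ => (1 : ℝ)) y with hm
  set W := ∑ j ∈ S, w j with hW
  have hcard : (0 : ℝ) < S.card := by exact_mod_cast hS.card_pos
  have hWge : S.card * (a / 2) ≤ W := by
    rw [hW, ← nsmul_eq_mul]
    exact S.card_nsmul_le_sum _ _ fun j hj => by linarith [hw j hj]
  have hWpos : 0 < W := lt_of_lt_of_le (by positivity) hWge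
  have hym : ∀ j ∈ S, ‖y j - m‖ ≤ r := fun j hj => by
    rw [norm_sub_rev]
    exact norm_centerMass_sub_le (fun _ _ => zero_le_one) (by simpa using hcard)
      fun i hi => hy i hi j hj
  have hsum : ∑ j ∈ S, (y j - m) = 0 := by
    have : (S.card : ℝ) • m = ∑ j ∈ S, y j := by
      rw [hm, Finset.centerMass]
      simp [smul_smul, hcard.ne']
    rw [Finset.sum_sub_distrib, Finset.sum_const, ← Nat.cast_smul_eq_nsmul ℝ, this, sub_self]
  -- The deviations from the plain mean sum to zero, so subtracting the constant `a` from all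
  -- weights is free.
  have hdiff : W • (S.centerMass w y - m) = ∑ j ∈ S, (w j - a) • (y j - m) := by
    have h₁ : ∑ j ∈ S, (w j - a) • (y j - m) = ∑ j ∈ S, w j • (y j - m) := by
      simp_rw [sub_smul (w _) a]
      rw [Finset.sum_sub_distrib, ← Finset.smul_sum, hsum, smul_zero, sub_zero]
    rw [h₁, Finset.centerMass, smul_sub, smul_smul, mul_inv_cancel₀ hWpos.ne', one_smul]
    simp_rw [smul_sub]
    rw [Finset.sum_sub_distrib, ← Finset.sum_smul]
  have hr : 0 ≤ r := by
    obtain ⟨j, hj⟩ := hS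
    exact (norm_nonneg _).trans (hy j hj j hj)
  have hε0 : 0 ≤ ε := by
    obtain ⟨j, hj⟩ := hS
    linarith [hw j hj, hw' j hj]
  have hbound : W * ‖S.centerMass w y - m‖ ≤ S.card * (ε * r) := by
    rw [← Real.norm_of_nonneg hWpos.le, ← norm_smul, hdiff, ← nsmul_eq_mul]
    refine (norm_sum_le _ _).trans (S.sum_le_card_nsmul _ _ fun j hj => ?_)
    rw [norm_smul]
    refine mul_le_mul ?_ (hym j hj) (norm_nonneg _) hε0
    rw [Real.norm_eq_abs, abs_le]
    constructor <;> linarith [hw j hj, hw' j hj]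
  have h₂ : S.card * (a / 2) * ‖S.centerMass w y - m‖ ≤ S.card * (ε * r) :=
    (mul_le_mul_of_nonneg_right hWge (norm_nonneg _)).trans hbound
  rw [mul_assoc, mul_le_mul_iff_right₀ hcard] at h₂
  rw [div_mul_eq_mul_div, le_div_iff₀ ha]
  linarith

-- Green's identity for the weighted graph Laplacian: swapping `i` and `j` shows that the `q i` and
-- `q j` halves contribute equally. It is applied with `q` the step and with `q` the configuration
-- itself.
open scoped RealInnerProductSpace in
theorem sum_sum_mul_inner_sub [Fintype ι] {W : ι → ι → ℝ} (hW : ∀ i j, W i j = W j i)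
    (p q : ι → E) :
    ∑ i, ∑ j, W i j * ⟪p i - p j, q i - q j⟫
      = 2 * ∑ i, ⟪∑ j, W i j • (p i - p j), q i⟫ := by
  have h₁ : ∑ i, ∑ j, W i j * ⟪p i - p j, q i⟫ = ∑ i, ⟪∑ j, W i j • (p i - p j), q i⟫ := by
    simp_rw [sum_inner, real_inner_smul_left]
  have h₂ : ∑ i, ∑ j, W i j * ⟪p i - p j, q j⟫ = -∑ i, ∑ j, W i j * ⟪p i - p j, q i⟫ := by
    rw [Finset.sum_comm]
    simp_rw [← Finset.sum_neg_distrib]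
    refine Finset.sum_congr rfl fun i _ => Finset.sum_congr rfl fun j _ => ?_
    rw [hW j i, ← neg_sub (p i) (p j), inner_neg_left, mul_neg]
  simp_rw [inner_sub_right, mul_sub, Finset.sum_sub_distrib]
  rw [h₂, h₁]
  ring

end Mean

/-! ### Energy estimates for a single update. -/

section Step

variable {ι E : Type*} [Fintype ι] [NormedAddCommGroup E] [InnerProductSpace ℝ E]
  {w : E → E → ℝ} {a ρ c : ℝ} {y y' : ι → E}

omit [InnerProductSpace ℝ E] in
theorem IsTruncatedWeight.sum_pos (hw : IsTruncatedWeight w a ρ c) (y : ι → E) (i : ι) :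
    0 < ∑ j, w (y i) (y j) :=
  Finset.sum_pos' (fun j _ => hw.nonneg _ _) ⟨i, Finset.mem_univ _, by rw [hw.self]; exact hw.pos⟩

theorem IsTruncatedWeight.sum_smul_sub (hw : IsTruncatedWeight w a ρ c)
    (hy : ∀ i, y' i = Finset.univ.centerMass (fun j => w (y i) (y j)) y) (i : ι) :
    ∑ j, w (y i) (y j) • (y i - y j) = -((∑ j, w (y i) (y j)) • (y' i - y i)) := by
  rw [hy, Finset.centerMass, smul_sub, smul_smul, mul_inv_cancel₀ (hw.sum_pos y i).ne', one_smul]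
  simp_rw [smul_sub]
  rw [Finset.sum_sub_distrib, ← Finset.sum_smul, neg_sub]

-- By Green's identity and the parallelogram law all terms in `‖δ i‖²` cancel, and the right side
-- equals `∑ w ‖δ i + δ j‖²`. Its diagonal `i = j` alone gives the left side.
open scoped RealInnerProductSpace in
theorem IsTruncatedWeight.energy_decrease (hw : IsTruncatedWeight w a ρ c)
    (hy : ∀ i, y' i = Finset.univ.centerMass (fun j => w (y i) (y j)) y) :
    4 * a * ∑ i, ‖y' i - y i‖ ^ 2
      ≤ ∑ i, ∑ j, w (y i) (y j) * (‖y i - y j‖ ^ 2 - ‖y' i - y' j‖ ^ 2) := by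
  set δ : ι → E := fun i => y' i - y i with hδ
  have hδi : ∀ i, y' i - y i = δ i := fun _ => rfl
  have hcross : ∑ i, ∑ j, w (y i) (y j) * ⟪y i - y j, δ i - δ j⟫
      = -2 * ∑ i, ∑ j, w (y i) (y j) * ‖δ i‖ ^ 2 := by
    rw [sum_sum_mul_inner_sub fun i j => hw.comm _ _]
    simp_rw [hw.sum_smul_sub hy, inner_neg_left, real_inner_smul_left, hδi,
      real_inner_self_eq_norm_sq, Finset.sum_neg_distrib, Finset.sum_mul]
    ring
  have hswap : ∑ i, ∑ j, w (y i) (y j) * ‖δ j‖ ^ 2 = ∑ i, ∑ j, w (y i) (y j) * ‖δ i‖ ^ 2 := by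
    rw [Finset.sum_comm]
    simp_rw [hw.comm (y _) (y _)]
  have hexp : ∀ i j, w (y i) (y j) * (‖y i - y j‖ ^ 2 - ‖y' i - y' j‖ ^ 2)
      = w (y i) (y j) * ‖δ i + δ j‖ ^ 2 - 2 * (w (y i) (y j) * ‖δ i‖ ^ 2)
        - 2 * (w (y i) (y j) * ‖δ j‖ ^ 2) - 2 * (w (y i) (y j) * ⟪y i - y j, δ i - δ j⟫) := by
    intro i j
    have e : y' i - y' j = (y i - y j) + (δ i - δ j) := by simp only [hδ]; abel
    rw [e, norm_add_sq_real]
    have := parallelogram_law_with_norm ℝ (δ i) (δ j)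
    linear_combination (-w (y i) (y j)) * this
  simp_rw [hexp, Finset.sum_sub_distrib, ← Finset.mul_sum]
  rw [hcross, hswap]
  have hdiag : 4 * a * ∑ i, ‖δ i‖ ^ 2 ≤ ∑ i, ∑ j, w (y i) (y j) * ‖δ i + δ j‖ ^ 2 := by
    rw [Finset.mul_sum]
    refine Finset.sum_le_sum fun i _ => ?_
    have h₁ := Finset.single_le_sum (f := fun j => w (y i) (y j) * ‖δ i + δ j‖ ^ 2)
      (fun j _ => mul_nonneg (hw.nonneg _ _) (sq_nonneg _)) (Finset.mem_univ i)
    refine le_trans (le_of_eq ?_) h₁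
    simp only [hw.self, ← two_smul ℝ (δ i), norm_smul, Real.norm_ofNat]
    ring
  linarith

-- Green's identity pairs the Laplacian, which is the step times a total weight of at most `card ι *
-- a`, with the bounded positions.
open scoped RealInnerProductSpace in
theorem IsTruncatedWeight.energy_le (hw : IsTruncatedWeight w a ρ c)
    (hy : ∀ i, y' i = Finset.univ.centerMass (fun j => w (y i) (y j)) y) {R : ℝ}
    (hR : ∀ i, ‖y i‖ ≤ R) :
    ∑ i, ∑ j, w (y i) (y j) * ‖y i - y j‖ ^ 2
      ≤ 2 * (Fintype.card ι * a * R) * ∑ i, ‖y' i - y i‖ := by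
  simp_rw [← real_inner_self_eq_norm_sq]
  rw [sum_sum_mul_inner_sub fun i j => hw.comm _ _, mul_assoc (2 : ℝ)]
  refine mul_le_mul_of_nonneg_left ?_ zero_le_two
  rw [Finset.mul_sum]
  refine Finset.sum_le_sum fun i _ => ?_
  rw [hw.sum_smul_sub hy]
  refine (real_inner_le_norm _ _).trans ?_
  rw [norm_neg, norm_smul, Real.norm_of_nonneg (hw.sum_pos y i).le]
  have h₁ : ∑ j, w (y i) (y j) ≤ Fintype.card ι * a := by
    rw [← nsmul_eq_mul]
    exact Finset.univ.sum_le_card_nsmul (fun j => w (y i) (y j)) a fun j _ => hw.le _ _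
  calc (∑ j, w (y i) (y j)) * ‖y' i - y i‖ * ‖y i‖
      ≤ Fintype.card ι * a * ‖y' i - y i‖ * R := by
        have := hw.pos
        gcongr
        exact hR i
    _ = _ := by ring

theorem IsTruncatedWeight.norm_le (hw : IsTruncatedWeight w a ρ c)
    (hy : ∀ i, y' i = Finset.univ.centerMass (fun j => w (y i) (y j)) y) {R : ℝ}
    (hR : ∀ i, ‖y i‖ ≤ R) (i : ι) : ‖y' i‖ ≤ R := by
  rw [hy, ← sub_zero (Finset.centerMass _ _ _)]
  exact norm_centerMass_sub_le (fun j _ => hw.nonneg _ _) (hw.sum_pos y i)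
    fun j _ => by simpa using hR j

end Step

/-! ### Rates of convergence for real sequences. -/

theorem tendsto_zero_of_mul_le_sub {L s : ℕ → ℝ} {κ : ℝ} (hκ : 0 < κ) (hs : ∀ t, 0 ≤ s t)
    (hL : ∀ t, κ * s t ≤ L (t + 1) - L t) (hb : BddAbove (range L)) :
    Tendsto s atTop (𝓝 0) := by
  have hmono : Monotone L := monotone_nat_of_le_succ fun t => by
    linarith [hL t, mul_nonneg hκ.le (hs t)]
  have hlim := tendsto_atTop_ciSup hmono hb
  have hsub := ((hlim.comp (tendsto_add_atTop_nat 1)).sub hlim).div_const κ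
  rw [sub_self, zero_div] at hsub
  refine squeeze_zero hs (fun t => ?_) hsub
  rw [le_div_iff₀ hκ, mul_comm]
  exact hL t

section Halving

theorem le_mul_half_pow {D : ℕ → ℝ} {T : ℕ} (hD : ∀ t, T ≤ t → D (t + 1) ≤ D t / 2) (n : ℕ) :
    D (T + n) ≤ D T * (1 / 2) ^ n := by
  induction n with
  | zero => simp
  | succ n ih =>
    have := hD (T + n) (by omega)
    rw [pow_succ, ← add_assoc]
    linarith

theorem exists_tendsto_of_halving {X : Type*} [PseudoMetricSpace X] [CompleteSpace X]
    {f : ℕ → X} {D : ℕ → ℝ} {T : ℕ} (hD : ∀ t, T ≤ t → D (t + 1) ≤ D t / 2)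
    (hf : ∀ t, T ≤ t → dist (f t) (f (t + 1)) ≤ D t) :
    ∃ x, Tendsto f atTop (𝓝 x) ∧ ∀ t, T ≤ t → dist (f t) x ≤ 2 * D t := by
  have hgeo : ∀ t, T ≤ t → ∀ n, dist (f (t + n)) (f (t + (n + 1))) ≤ 2 * D t / 2 / 2 ^ n := by
    intro t ht n
    refine (hf (t + n) (by omega)).trans
      ((le_mul_half_pow (fun s hs => hD s (ht.trans hs)) n).trans (le_of_eq ?_))
    rw [one_div, inv_pow]
    ring
  obtain ⟨x, hx⟩ := cauchySeq_tendsto_of_complete (cauchySeq_of_le_geometric_two (hgeo T le_rfl))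
  have hx' : Tendsto f atTop (𝓝 x) := by
    rw [← tendsto_add_atTop_iff_nat T]
    simpa only [add_comm] using hx
  refine ⟨x, hx', fun t ht => ?_⟩
  refine dist_le_of_le_geometric_two_of_tendsto₀ (f := fun n => f (t + n)) (hgeo t ht) ?_
  simpa only [add_comm] using (tendsto_add_atTop_iff_nat t).2 hx'

theorem tendsto_zero_of_halving {D : ℕ → ℝ} {T : ℕ} (hD0 : ∀ t, 0 ≤ D t)
    (hD : ∀ t, T ≤ t → D (t + 1) ≤ D t / 2) : Tendsto D atTop (𝓝 0) := by
  rw [← tendsto_add_atTop_iff_nat T]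
  have h : Tendsto (fun n : ℕ => D T * (1 / 2 : ℝ) ^ n) atTop (𝓝 (D T * 0)) :=
    (tendsto_pow_atTop_nhds_zero_of_lt_one (by norm_num) (by norm_num)).const_mul _
  rw [mul_zero] at h
  refine squeeze_zero (fun _ => hD0 _) (fun n => ?_) h
  rw [add_comm]
  exact le_mul_half_pow hD n

theorem isBigO_half_pow_of_halving {D : ℕ → ℝ} {T : ℕ} (hD0 : ∀ t, 0 ≤ D t)
    (hD : ∀ t, T ≤ t → D (t + 1) ≤ D t / 2) : D =O[atTop] fun t : ℕ => (1 / 2 : ℝ) ^ t := by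
  refine IsBigO.of_bound (D T * 2 ^ T) ?_
  filter_upwards [eventually_ge_atTop T] with t ht
  obtain ⟨n, rfl⟩ := Nat.exists_eq_add_of_le ht
  rw [Real.norm_of_nonneg (hD0 _), Real.norm_of_nonneg (by positivity)]
  refine (le_mul_half_pow hD n).trans (le_of_eq ?_)
  rw [pow_add, one_div, inv_pow, inv_pow]
  field_simp

/-- A null sequence that is eventually cubically contracted converges at a doubly exponential
rate. -/
theorem exists_isBigO_pow_three_pow {e : ℕ → ℝ} {p : ℝ} {T : ℕ} (hp : 0 < p) (he0 : ∀ t, 0 ≤ e t)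
    (hlim : Tendsto e atTop (𝓝 0)) (he : ∀ t, T ≤ t → e (t + 1) ≤ p * e t ^ 3) :
    ∃ q : ℝ, 0 < q ∧ q < 1 ∧ e =O[atTop] fun t : ℕ => q ^ 3 ^ t := by
  -- Multiplying by `√p` normalizes the recursion to `x ↦ x ^ 3`; it is started once `√p * e t < 1 /
  -- 2`. The rate `q` below absorbs the delay `S` through `q ^ 3 ^ S = 1 / 2`.
  have hev : ∀ᶠ t in atTop, e t < 1 / (2 * √p) := hlim.eventually (gt_mem_nhds (by positivity))
  obtain ⟨S, hS, hTS⟩ := (hev.and (eventually_ge_atTop T)).exists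
  have hsp : 0 < √p := Real.sqrt_pos.2 hp
  have hsq : √p ^ 2 = p := Real.sq_sqrt hp.le
  set q : ℝ := (1 / 2 : ℝ) ^ ((3 ^ S : ℝ)⁻¹) with hq
  have hqS : q ^ 3 ^ S = 1 / 2 := by
    have := Real.rpow_inv_natCast_pow (show (0 : ℝ) ≤ 1 / 2 by norm_num)
      (show (3 ^ S : ℕ) ≠ 0 by positivity)
    push_cast at this
    exact this
  have hbound : ∀ n, √p * e (S + n) ≤ (1 / 2) ^ 3 ^ n := by
    intro n
    induction n with
    | zero =>
      rw [lt_div_iff₀ (by positivity)] at hS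
      simp only [add_zero, pow_zero, pow_one]
      linarith
    | succ n ih =>
      calc √p * e (S + n + 1) ≤ √p * (p * e (S + n) ^ 3) :=
            mul_le_mul_of_nonneg_left (he _ (by omega)) hsp.le
        _ = (√p * e (S + n)) ^ 3 := by nth_rw 2 [← hsq]; ring
        _ ≤ ((1 / 2) ^ 3 ^ n) ^ 3 :=
            pow_le_pow_left₀ (mul_nonneg hsp.le (he0 _)) ih 3
        _ = _ := by rw [← pow_mul, ← pow_succ]
  refine ⟨q, by positivity, Real.rpow_lt_one (by norm_num) (by norm_num) (by positivity), ?_⟩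
  refine IsBigO.of_bound (1 / √p) ?_
  filter_upwards [eventually_ge_atTop S] with t ht
  obtain ⟨n, rfl⟩ := Nat.exists_eq_add_of_le ht
  rw [Real.norm_of_nonneg (he0 _), Real.norm_of_nonneg (by positivity), pow_add, pow_mul, hqS,
    one_div_mul_eq_div, le_div_iff₀ hsp, mul_comm]
  exact hbound n

end Halving

/-! ### Freezing of the interaction graph. -/

section Sequence

variable {ι E : Type*} [Fintype ι] [NormedAddCommGroup E] [InnerProductSpace ℝ E]
  {w : E → E → ℝ} {a ρ c : ℝ} {Y : ℕ → ι → E}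

theorem IsTruncatedWeight.eventually_near_of_ne_zero (hw : IsTruncatedWeight w a ρ c)
    (hY : ∀ t i, Y (t + 1) i = Finset.univ.centerMass (fun j => w (Y t i) (Y t j)) (Y t))
    (hδ : Tendsto (fun t => ∑ i, ‖Y (t + 1) i - Y t i‖ ^ 2) atTop (𝓝 0)) {ε : ℝ} (hε : 0 < ε) :
    ∀ᶠ t in atTop, (∀ i j, w (Y t i) (Y t j) ≠ 0 → ‖Y t i - Y t j‖ < ε) ∧
      ∀ i, ‖Y (t + 1) i - Y t i‖ < ε := by
  have hδi : ∀ i, Tendsto (fun t => ‖Y (t + 1) i - Y t i‖) atTop (𝓝 0) := by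
    intro i
    have h : Tendsto (fun t => ‖Y (t + 1) i - Y t i‖ ^ 2) atTop (𝓝 0) :=
      squeeze_zero (fun _ => sq_nonneg _) (fun t => Finset.single_le_sum
        (f := fun i => ‖Y (t + 1) i - Y t i‖ ^ 2) (fun _ _ => sq_nonneg _) (Finset.mem_univ i)) hδ
    simpa [Real.sqrt_sq] using h.sqrt
  have hR : ∀ t i, ‖Y t i‖ ≤ ∑ j, ‖Y 0 j‖ := by
    intro t
    induction t with
    | zero =>
      exact fun i => Finset.single_le_sum (f := fun j => ‖Y 0 j‖)
        (fun _ _ => norm_nonneg _) (Finset.mem_univ i)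
    | succ t ih => exact hw.norm_le (hY t) ih
  have henergy : Tendsto (fun t => ∑ i, ∑ j, w (Y t i) (Y t j) * ‖Y t i - Y t j‖ ^ 2) atTop
      (𝓝 0) := by
    have h := (tendsto_finsetSum Finset.univ fun i _ => hδi i).const_mul
      (2 * (Fintype.card ι * a * ∑ j, ‖Y 0 j‖))
    rw [Finset.sum_const_zero, mul_zero] at h
    exact squeeze_zero (fun t => Finset.sum_nonneg fun i _ => Finset.sum_nonneg fun j _ =>
      mul_nonneg (hw.nonneg _ _) (sq_nonneg _)) (fun t => hw.energy_le (hY t) (hR t)) h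
  have hc := hw.lower_pos
  filter_upwards [henergy.eventually (gt_mem_nhds (show 0 < c * ε ^ 2 by positivity)),
    eventually_all.2 fun i => (hδi i).eventually (gt_mem_nhds hε)] with t h₁ h₂
  refine ⟨fun i j hij => ?_, h₂⟩
  have hterm : w (Y t i) (Y t j) * ‖Y t i - Y t j‖ ^ 2 < c * ε ^ 2 := by
    refine lt_of_le_of_lt ?_ h₁
    refine le_trans ?_ (Finset.single_le_sum
      (f := fun i => ∑ j, w (Y t i) (Y t j) * ‖Y t i - Y t j‖ ^ 2)
      (fun i _ => Finset.sum_nonneg fun j _ => mul_nonneg (hw.nonneg _ _) (sq_nonneg _))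
      (Finset.mem_univ i))
    exact Finset.single_le_sum (f := fun j => w (Y t i) (Y t j) * ‖Y t i - Y t j‖ ^ 2)
      (fun j _ => mul_nonneg (hw.nonneg _ _) (sq_nonneg _)) (Finset.mem_univ j)
  have h₃ := mul_le_mul_of_nonneg_right (hw.lower_of_ne _ _ hij) (sq_nonneg ‖Y t i - Y t j‖)
  exact lt_of_pow_lt_pow_left₀ 2 hε.le (lt_of_mul_lt_mul_left (h₃.trans_lt hterm) hc.le)

/-- From some step on, points interact iff they are related by a fixed equivalence relation, and
unrelated points are at distance at least `ρ`. -/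
theorem IsTruncatedWeight.exists_equivalence (hw : IsTruncatedWeight w a ρ c)
    (hY : ∀ t i, Y (t + 1) i = Finset.univ.centerMass (fun j => w (Y t i) (Y t j)) (Y t))
    (hδ : Tendsto (fun t => ∑ i, ‖Y (t + 1) i - Y t i‖ ^ 2) atTop (𝓝 0)) :
    ∃ (τ : ℕ) (r : Setoid ι), (∀ t, τ ≤ t → ∀ i j, w (Y t i) (Y t j) ≠ 0 ↔ r i j) ∧
      ∀ t, τ ≤ t → ∀ i j, ¬ r i j → ρ ≤ ‖Y t i - Y t j‖ := by
  have hρ := hw.radius_pos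
  obtain ⟨τ, hτ⟩ := eventually_atTop.1
    -- With `ρ / 3`, distances change by less than `2 * ρ / 3` per step, too little to cross from
    -- below `ρ / 3` to `ρ` or back. Two interacting links span less than `ρ`, which gives
    -- transitivity.
    (hw.eventually_near_of_ne_zero hY hδ (show 0 < ρ / 3 by positivity))
  have hiff : ∀ t, τ ≤ t → ∀ i j, w (Y t i) (Y t j) ≠ 0 ↔ ‖Y t i - Y t j‖ < ρ / 3 :=
    fun t ht i j => ⟨(hτ t ht).1 i j, fun h =>
      (hw.lower_pos.trans_le (hw.lower_of_lt _ _ (by linarith))).ne'⟩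
  have hfar : ∀ t, τ ≤ t → ∀ i j, w (Y t i) (Y t j) = 0 → ρ ≤ ‖Y t i - Y t j‖ := by
    intro t ht i j h0
    by_contra! hlt
    exact (hw.lower_pos.trans_le (hw.lower_of_lt _ _ hlt)).ne' h0
  have hstep : ∀ t, τ ≤ t → ∀ i j, |‖Y (t + 1) i - Y (t + 1) j‖ - ‖Y t i - Y t j‖| < 2 * ρ / 3 := by
    intro t ht i j
    have e : Y (t + 1) i - Y (t + 1) j - (Y t i - Y t j)
        = (Y (t + 1) i - Y t i) - (Y (t + 1) j - Y t j) := by abel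
    have h₁ := abs_norm_sub_norm_le (Y (t + 1) i - Y (t + 1) j) (Y t i - Y t j)
    rw [e] at h₁
    have h₂ := norm_sub_le (Y (t + 1) i - Y t i) (Y (t + 1) j - Y t j)
    linarith [(hτ t ht).2 i, (hτ t ht).2 j]
  have hconst : ∀ t, τ ≤ t → ∀ i j, w (Y t i) (Y t j) ≠ 0 ↔ w (Y τ i) (Y τ j) ≠ 0 := by
    intro t ht i j
    induction t, ht using Nat.le_induction with
    | base => rfl
    | succ t ht ih =>
      rw [← ih]
      have h := abs_lt.1 (hstep t ht i j)
      constructor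
      · intro hne hzero
        have := (hiff (t + 1) (by omega) i j).1 hne
        linarith [hfar t ht i j hzero]
      · intro hne hzero
        have := (hiff t ht i j).1 hne
        linarith [hfar (t + 1) (by omega) i j hzero]
  refine ⟨τ, ⟨fun i j => w (Y τ i) (Y τ j) ≠ 0, ⟨?_, ?_, ?_⟩⟩, hconst, ?_⟩
  · intro i
    rw [hw.self]
    exact hw.pos.ne'
  · intro i j hij
    rwa [hw.comm]
  · intro i j l hij hjl
    by_contra hzero
    have := norm_sub_le_norm_sub_add_norm_sub (Y τ i) (Y τ j) (Y τ l)
    linarith [hfar τ le_rfl i l hzero, (hiff τ le_rfl i j).1 hij, (hiff τ le_rfl j l).1 hjl]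
  · intro t ht i j hij
    exact hfar t ht i j (not_not.1 fun hne => hij ((hconst t ht i j).1 hne))

open Classical in
/-- The sum of the distances between related points. -/
noncomputable def relatedSpread (r : Setoid ι) (y : ι → E) : ℝ :=
  ∑ i, ∑ j, if r i j then ‖y i - y j‖ else 0

omit [InnerProductSpace ℝ E] in
theorem relatedSpread_nonneg (r : Setoid ι) (y : ι → E) : 0 ≤ relatedSpread r y :=
  Finset.sum_nonneg fun i _ => Finset.sum_nonneg fun j _ => by split_ifs <;> positivity

omit [InnerProductSpace ℝ E] in
theorem norm_sub_le_relatedSpread {r : Setoid ι} (y : ι → E) {i j : ι} (hij : r i j) :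
    ‖y i - y j‖ ≤ relatedSpread r y := by
  classical
  have h₁ := Finset.single_le_sum (f := fun j => if r i j then ‖y i - y j‖ else 0)
    (fun j _ => by split_ifs <;> positivity) (Finset.mem_univ j)
  have h₂ := Finset.single_le_sum (f := fun i => ∑ j, if r i j then ‖y i - y j‖ else 0)
    (fun i _ => Finset.sum_nonneg fun j _ => by split_ifs <;> positivity) (Finset.mem_univ i)
  simp only [hij, if_true] at h₁
  refine h₁.trans (h₂.trans (le_of_eq ?_))
  unfold relatedSpread
  congr! 4

omit [InnerProductSpace ℝ E] in
theorem relatedSpread_le {r : Setoid ι} {y : ι → E} {b : ℝ} (hb : 0 ≤ b)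
    (h : ∀ i j, r i j → ‖y i - y j‖ ≤ b) : relatedSpread r y ≤ Fintype.card ι ^ 2 * b := by
  classical
  unfold relatedSpread
  have h₁ : ∀ i j, (if r i j then ‖y i - y j‖ else 0) ≤ b := fun i j => by
    split_ifs with hij
    exacts [h i j hij, hb]
  refine (Finset.sum_le_sum fun i _ => Finset.sum_le_sum fun j _ => h₁ i j).trans (le_of_eq ?_)
  simp only [Finset.sum_const, Finset.card_univ, nsmul_eq_mul]
  ring

end Sequence

/-! ### Contraction of the spread within classes. -/

section Contraction

variable {ι E : Type*} [Fintype ι] [NormedAddCommGroup E] [InnerProductSpace ℝ E]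
  {w : E → E → ℝ} {a ρ c : ℝ} {y y' : ι → E} {r : Setoid ι}

open Classical in
theorem centerMass_eq_centerMass_related (hr : ∀ i j, w (y i) (y j) ≠ 0 ↔ r i j) (i : ι) :
    Finset.univ.centerMass (fun j => w (y i) (y j)) y
      = ({j | r i j} : Finset ι).centerMass (fun j => w (y i) (y j)) y := by
  rw [← Finset.centerMass_filter_ne_zero]
  congr 1
  ext j
  simp only [Finset.mem_filter, Finset.mem_univ, true_and]
  exact hr i j

theorem IsTruncatedWeight.norm_step_sub_le (hw : IsTruncatedWeight w a ρ c)
    (hy : ∀ i, y' i = Finset.univ.centerMass (fun j => w (y i) (y j)) y)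
    (hr : ∀ i j, w (y i) (y j) ≠ 0 ↔ r i j) (i : ι) :
    ‖y' i - y i‖ ≤ relatedSpread r y := by
  classical
  rw [hy, centerMass_eq_centerMass_related hr]
  refine norm_centerMass_sub_le (fun j _ => hw.nonneg _ _) ?_ fun j hj => ?_
  · refine Finset.sum_pos' (fun j _ => hw.nonneg _ _) ⟨i, ?_, ?_⟩
    · simp
    · rw [hw.self]
      exact hw.pos
  · exact norm_sub_le_relatedSpread y (r.symm (by simpa using hj))

/-- Related points average over the same class, so both land near the same plain mean. Keeping `ε`
free serves both rates: a small constant gives halving, a multiple of the squared spread gives the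
cubic bound. -/
theorem IsTruncatedWeight.relatedSpread_step_le (hw : IsTruncatedWeight w a ρ c)
    (hy : ∀ i, y' i = Finset.univ.centerMass (fun j => w (y i) (y j)) y)
    (hr : ∀ i j, w (y i) (y j) ≠ 0 ↔ r i j) {ε : ℝ} (hε0 : 0 ≤ ε) (hε : ε ≤ a / 2)
    (hnear : ∀ i j, r i j → a - ε ≤ w (y i) (y j)) :
    relatedSpread r y' ≤ Fintype.card ι ^ 2 * (4 * ε / a * relatedSpread r y) := by
  classical
  have ha := hw.pos
  have hD := relatedSpread_nonneg r y
  refine relatedSpread_le (by positivity) fun i j hij => ?_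
  have hmean : ∀ i, ‖y' i - ({j | r i j} : Finset ι).centerMass (fun _ => (1 : ℝ)) y‖
      ≤ 2 * ε / a * relatedSpread r y := by
    intro i
    rw [hy, centerMass_eq_centerMass_related hr]
    refine norm_centerMass_sub_mean_le ⟨i, by simp⟩ ha hε
      (fun j hj => hnear i j (by simpa using hj)) (fun j _ => hw.le _ _) fun j hj l hl => ?_
    exact norm_sub_le_relatedSpread y
      (r.trans (r.symm (by simpa using hj)) (by simpa using hl : r i l))
  have hS : ({l | r i l} : Finset ι) = ({l | r j l} : Finset ι) := by
    ext l
    simp only [Finset.mem_filter, Finset.mem_univ, true_and]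
    exact ⟨fun h => r.trans (r.symm hij) h, fun h => r.trans hij h⟩
  have h₁ := hmean i
  have h₂ := hmean j
  rw [← hS, norm_sub_rev] at h₂
  have h₃ := norm_sub_le_norm_sub_add_norm_sub (y' i)
    (({l | r i l} : Finset ι).centerMass (fun _ => (1 : ℝ)) y) (y' j)
  calc ‖y' i - y' j‖ ≤ 2 * ε / a * relatedSpread r y + 2 * ε / a * relatedSpread r y := by linarith
    _ = 4 * ε / a * relatedSpread r y := by ring

end Contraction

/-! ### Convergence of the blurring mean shift sequence. -/

section BlurringMeanShift

variable {n d : ℕ} {K : EuclideanSpace ℝ (Fin d) → ℝ} {k g : ℝ → ℝ} {h : ℝ}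

theorem Configuration.norm_le_sum (u : Configuration n d) : ‖u‖ ≤ ∑ i, ‖u i‖ := by
  rw [PiLp.norm_eq_of_L2]
  refine Real.sqrt_le_iff.2 ⟨Finset.sum_nonneg fun _ _ => norm_nonneg _, ?_⟩
  exact Finset.sum_sq_le_sq_sum_of_nonneg fun _ _ => norm_nonneg _

theorem bmsSequence_succ_apply (x : Configuration n d) (t : ℕ) (i : Fin n) :
    bmsSequence g h x (t + 1) i = Finset.univ.centerMass
      (fun j => bmsWeight g h (bmsSequence g h x t i) (bmsSequence g h x t j))
      (fun j => bmsSequence g h x t j) := by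
  unfold bmsSequence
  rw [Function.iterate_succ_apply']
  rfl

/-- The subgradient inequality in the squared distances, summed over pairs, bounds the gain below by
the weighted energy decrease over `2 * h ^ 2`. -/
theorem bmsObjective_ascent (hK : IsKernelWithProfile K k) (hg : IsWeightProfile k g)
    (hh : 0 < h) {ρ c : ℝ} (hw : IsTruncatedWeight (bmsWeight (d := d) g h) (g 0) ρ c)
    (x : Configuration n d) (t : ℕ) :
    2 * g 0 / h ^ 2 * ∑ i, ‖bmsSequence g h x (t + 1) i - bmsSequence g h x t i‖ ^ 2
      ≤ bmsObjective K h (bmsSequence g h x (t + 1)) - bmsObjective K h (bmsSequence g h x t) := by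
  set y := bmsSequence g h x t
  set y' := bmsSequence g h x (t + 1)
  have hdec := hw.energy_decrease (y := fun i => y i) (y' := fun i => y' i)
    fun i => bmsSequence_succ_apply x t i
  have hle : ∑ i, ∑ j, 1 / (2 * h ^ 2) *
      (bmsWeight g h (y i) (y j) * (‖y i - y j‖ ^ 2 - ‖y' i - y' j‖ ^ 2))
      ≤ ∑ i, ∑ j, (K (h⁻¹ • (y' i - y' j)) - K (h⁻¹ • (y i - y j))) := by
    refine Finset.sum_le_sum fun i _ => Finset.sum_le_sum fun j _ => ?_
    rw [kernel_eq hK hh, kernel_eq hK hh, bmsWeight_eq hh]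
    have := hg.subgradient_le hK.convex
      (by positivity : 0 ≤ ‖y i - y j‖ ^ 2 / (2 * h ^ 2))
      (by positivity : 0 ≤ ‖y' i - y' j‖ ^ 2 / (2 * h ^ 2))
    refine le_trans (le_of_eq ?_) (sub_le_sub_right this _)
    ring
  simp_rw [← Finset.mul_sum, Finset.sum_sub_distrib] at hle
  refine le_trans ?_ hle
  have := mul_le_mul_of_nonneg_left hdec (by positivity : 0 ≤ 1 / (2 * h ^ 2))
  refine le_trans (le_of_eq ?_) this
  field_simp
  ring

theorem bddAbove_bmsObjective (hK : IsKernelWithProfile K k) (u : ℕ → Configuration n d) :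
    BddAbove (range fun t => bmsObjective K h (u t)) := by
  obtain ⟨C, hC⟩ := hK.bounded
  refine ⟨∑ _i : Fin n, ∑ _j : Fin n, C, ?_⟩
  rintro _ ⟨t, rfl⟩
  exact Finset.sum_le_sum fun i _ => Finset.sum_le_sum fun j _ => (le_abs_self _).trans (hC _)

/-- The long-term behaviour of the blurring mean shift sequence: from step `τ` on, points interact
iff they are related by a fixed equivalence relation, and the spread of the classes is eventually
halved in each step. -/
theorem exists_limit_bmsSequence (hK : IsKernelWithProfile K k) (hg : IsWeightProfile k g)
    (hh : 0 < h) {ρ c : ℝ} (hw : IsTruncatedWeight (bmsWeight (d := d) g h) (g 0) ρ c)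
    (x : Configuration n d) :
    ∃ (ybar : Configuration n d) (τ T : ℕ) (r : Setoid (Fin n)),
      Tendsto (bmsSequence g h x) atTop (𝓝 ybar) ∧
      (∀ t, τ ≤ t → ∀ i j,
        bmsWeight g h (bmsSequence g h x t i) (bmsSequence g h x t j) ≠ 0 ↔ r i j) ∧
      (∀ t, τ ≤ t → ∀ i j, ¬ r i j → ρ ≤ ‖bmsSequence g h x t i - bmsSequence g h x t j‖) ∧
      τ ≤ T ∧
      (∀ t, T ≤ t → relatedSpread r (fun i => bmsSequence g h x (t + 1) i)
        ≤ relatedSpread r (fun i => bmsSequence g h x t i) / 2) ∧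
      ∀ t, T ≤ t → ‖bmsSequence g h x t - ybar‖
        ≤ 2 * n * relatedSpread r (fun i => bmsSequence g h x t i) := by
  have ha := hw.pos
  set Y : ℕ → Fin n → EuclideanSpace ℝ (Fin d) := fun t i => bmsSequence g h x t i with hYdef
  have hY : ∀ t i, Y (t + 1) i
      = Finset.univ.centerMass (fun j => bmsWeight g h (Y t i) (Y t j)) (Y t) :=
    fun t i => bmsSequence_succ_apply x t i
  have hδ : Tendsto (fun t => ∑ i, ‖Y (t + 1) i - Y t i‖ ^ 2) atTop (𝓝 0) :=
    tendsto_zero_of_mul_le_sub (by positivity : 0 < 2 * g 0 / h ^ 2)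
      (fun t => Finset.sum_nonneg fun _ _ => sq_nonneg _)
      (fun t => bmsObjective_ascent hK hg hh hw x t) (bddAbove_bmsObjective hK _)
  obtain ⟨τ, r, hr, hfar⟩ := hw.exists_equivalence hY hδ
  -- This `ε` makes the contraction factor at most `1 / 2`; the `+ 1` in the witness covers `n = 0`.
  obtain ⟨ε, hε, hε2, hεn⟩ : ∃ ε > 0, ε ≤ g 0 / 2 ∧ (n : ℝ) ^ 2 * (4 * ε / g 0) ≤ 1 / 2 := by
    refine ⟨g 0 / (8 * ((n : ℝ) ^ 2 + 1)), by positivity, ?_, ?_⟩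
    · exact div_le_div_of_nonneg_left ha.le two_pos (by nlinarith [sq_nonneg (n : ℝ)])
    · have e : (n : ℝ) ^ 2 * (4 * (g 0 / (8 * ((n : ℝ) ^ 2 + 1))) / g 0)
          = (n : ℝ) ^ 2 / ((n : ℝ) ^ 2 + 1) / 2 := by
        field_simp
        ring
      have : (n : ℝ) ^ 2 / ((n : ℝ) ^ 2 + 1) ≤ 1 := by
        rw [div_le_one (by positivity)]
        linarith
      linarith
  obtain ⟨δ, hδ0, hδw⟩ := hw.near_diagonal ε hε
  obtain ⟨T', hT'⟩ := eventually_atTop.1 (hw.eventually_near_of_ne_zero hY hδ hδ0)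
  set T := max τ T'
  have hτT : ∀ t, T ≤ t → τ ≤ t := fun t ht => (le_max_left _ _).trans ht
  have hhalf : ∀ t, T ≤ t → relatedSpread r (Y (t + 1)) ≤ relatedSpread r (Y t) / 2 := by
    intro t ht
    have h₁ := hw.relatedSpread_step_le (hY t) (hr t (hτT t ht)) hε.le hε2 fun i j hij =>
      hδw _ _ ((hT' t ((le_max_right _ _).trans ht)).1 i j ((hr t (hτT t ht) i j).2 hij)).le
    rw [Fintype.card_fin, ← mul_assoc] at h₁
    have := mul_le_mul_of_nonneg_right hεn (relatedSpread_nonneg r (Y t))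
    linarith
  have hdist : ∀ t, T ≤ t → dist (bmsSequence g h x t) (bmsSequence g h x (t + 1))
      ≤ n * relatedSpread r (Y t) := by
    intro t ht
    rw [dist_comm, dist_eq_norm]
    refine (Configuration.norm_le_sum _).trans ?_
    refine (Finset.sum_le_card_nsmul _ _ (relatedSpread r (Y t)) fun i _ =>
      hw.norm_step_sub_le (hY t) (hr t (hτT t ht)) i).trans (le_of_eq ?_)
    rw [Finset.card_univ, Fintype.card_fin, nsmul_eq_mul]
  obtain ⟨ybar, hlim, hbar⟩ := exists_tendsto_of_halving
    (D := fun t => n * relatedSpread r (Y t)) (T := T) (fun t ht => by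
      have := mul_le_mul_of_nonneg_left (hhalf t ht) n.cast_nonneg
      linarith) hdist
  refine ⟨ybar, τ, T, r, hlim, hr, hfar, le_max_left _ _, hhalf, fun t ht => ?_⟩
  rw [← dist_eq_norm, mul_assoc]
  exact hbar t ht

/-- Unrelated pairs contribute zero to both objectives. Related pairs coincide in `v`, and the
supporting line of `k` at `0` is linear in the squared distance, so the loss is quadratic. -/
theorem abs_bmsObjective_sub_le (hK : IsKernelWithProfile K k) (hg : IsWeightProfile k g)
    (hh : 0 < h) (ht : truncationPoint k < ⊤) {r : Setoid (Fin n)} {u v : Configuration n d}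
    (hv : ∀ i j, r i j → v i = v j)
    (hfar : ∀ i j, ¬ r i j → (truncationPoint k).toReal * h ≤ ‖u i - u j‖)
    (hfar' : ∀ i j, ¬ r i j → (truncationPoint k).toReal * h ≤ ‖v i - v j‖) :
    |bmsObjective K h v - bmsObjective K h u|
      ≤ n * (n * (g 0 * (2 / h ^ 2))) * ‖u - v‖ ^ 2 := by
  have hz : ∀ z : EuclideanSpace ℝ (Fin d), (truncationPoint k).toReal * h ≤ ‖z‖ →
      K (h⁻¹ • z) = 0 := by
    intro z hz
    rw [kernel_eq hK hh]
    refine hg.eq_zero_of_truncationPoint_le hK.convex hK.nonincreasing ht ?_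
    rw [div_le_div_iff₀ (by norm_num) (by positivity)]
    nlinarith [pow_le_pow_left₀ (by positivity) hz 2]
  have hterm : ∀ i j, |K (h⁻¹ • (v i - v j)) - K (h⁻¹ • (u i - u j))|
      ≤ g 0 * (2 / h ^ 2) * ‖u - v‖ ^ 2 := by
    intro i j
    have hg0 := hg.nonneg hK.convex hK.nonincreasing le_rfl
    by_cases hij : r i j
    · have hs : 0 ≤ ‖u i - u j‖ ^ 2 / (2 * h ^ 2) := by positivity
      rw [hv i j hij, sub_self, kernel_eq hK hh, kernel_eq hK hh, norm_zero]
      have h₀ : (0 : ℝ) ^ 2 / (2 * h ^ 2) = 0 := by simp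
      rw [h₀, abs_of_nonneg (sub_nonneg.2 (hK.nonincreasing (mem_Ici.2 le_rfl) (mem_Ici.2 hs) hs))]
      have h₁ := hg.subgradient_le hK.convex le_rfl hs
      have h₂ : ‖u i - u j‖ ≤ 2 * ‖u - v‖ := by
        have e : u i - u j = (u - v) i - (u - v) j := by
          simp [hv i j hij]
        rw [e]
        refine (norm_sub_le _ _).trans ?_
        linarith [PiLp.norm_apply_le (u - v) i, PiLp.norm_apply_le (u - v) j]
      have h₃ : ‖u i - u j‖ ^ 2 / (2 * h ^ 2) ≤ 2 / h ^ 2 * ‖u - v‖ ^ 2 := by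
        rw [div_le_iff₀ (by positivity)]
        have := pow_le_pow_left₀ (norm_nonneg _) h₂ 2
        refine this.trans (le_of_eq ?_)
        field_simp
      have := mul_le_mul_of_nonneg_left h₃ hg0
      rw [sub_zero] at h₁
      linarith
    · rw [hz _ (hfar i j hij), hz _ (hfar' i j hij), sub_self, abs_zero]
      positivity
  unfold bmsObjective
  rw [← Finset.sum_sub_distrib]
  simp_rw [← Finset.sum_sub_distrib]
  have h₁ : ∀ i, |∑ j, (K (h⁻¹ • (v i - v j)) - K (h⁻¹ • (u i - u j)))|
      ≤ n * (g 0 * (2 / h ^ 2) * ‖u - v‖ ^ 2) := by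
    intro i
    refine (Finset.abs_sum_le_sum_abs _ _).trans
      ((Finset.sum_le_card_nsmul _ _ _ fun j _ => hterm i j).trans (le_of_eq ?_))
    rw [Finset.card_univ, Fintype.card_fin, nsmul_eq_mul]
  refine (Finset.abs_sum_le_sum_abs _ _).trans
    ((Finset.sum_le_card_nsmul _ _ _ fun i _ => h₁ i).trans (le_of_eq ?_))
  rw [Finset.card_univ, Fintype.card_fin, nsmul_eq_mul]
  ring

/-- The converse of the bound on the distance to the limit by the spread; together they carry the
cubic recursion from the spread to that distance. -/
theorem relatedSpread_le_norm_sub {r : Setoid (Fin n)} {u v : Configuration n d}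
    (hv : ∀ i j, r i j → v i = v j) :
    relatedSpread r (fun i => u i) ≤ 2 * n ^ 2 * ‖u - v‖ := by
  have h := relatedSpread_le (r := r) (y := fun i => u i) (b := 2 * ‖u - v‖) (by positivity)
    fun i j hij => by
      have e : u i - u j = (u - v) i - (u - v) j := by simp [hv i j hij]
      rw [e]
      refine (norm_sub_le _ _).trans ?_
      linarith [PiLp.norm_apply_le (u - v) i, PiLp.norm_apply_le (u - v) j]
  rw [Fintype.card_fin] at h
  linarith

end BlurringMeanShift

/-! ### The main theorem. -/

theorem mainTheorem1 {n d : ℕ} (K : EuclideanSpace ℝ (Fin d) → ℝ) (k g : ℝ → ℝ) (h : ℝ)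
    (hK : IsKernelWithProfile K k) (hg : IsWeightProfile k g)
    (htrunc : IsNonSmoothlyTruncated k) (hh : 0 < h) (x : Configuration n d) :
    ∃ ybar : Configuration n d, Tendsto (bmsSequence g h x) atTop (𝓝 ybar) ∧
    ∃ τ : ℕ,
      -- from step `τ` on the graph is fixed and closed
      IsClosedGraph (bmsGraph g h (bmsSequence g h x τ)) ∧
      (∀ t, τ ≤ t → bmsGraph g h (bmsSequence g h x t) = bmsGraph g h (bmsSequence g h x τ)) ∧
      -- it is the graph of the limit, unless `g` is nonzero at the truncation point and two limit
      -- points have the critical distance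
      ((g ((truncationPoint k).toReal ^ 2 / 2) = 0 ∨
          ∀ i j, ‖ybar i - ybar j‖ ≠ (truncationPoint k).toReal * h) →
        ∀ t, τ ≤ t → bmsGraph g h (bmsSequence g h x t) = bmsGraph g h ybar) ∧
      -- one cluster point for each component, different for different components
      ∃ z : (bmsGraph g h (bmsSequence g h x τ)).ConnectedComponent → EuclideanSpace ℝ (Fin d),
        Function.Injective z ∧
        -- exponential rate
        (∃ q : ℝ, 3 / 4 ≤ q ∧ q < 1 ∧
          (fun t => bmsSequence g h x t - ybar) =O[atTop] (fun t : ℕ => q ^ t) ∧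
          (∀ m, ∀ i ∈ m.supp,
            (fun t => bmsSequence g h x t i - z m) =O[atTop] (fun t : ℕ => q ^ t)) ∧
          (fun t => bmsObjective K h ybar - bmsObjective K h (bmsSequence g h x t))
            =O[atTop] (fun t : ℕ => q ^ (2 * t))) ∧
        -- cubic rate
        (HasLipschitzDerivNearZero k →
          ∃ τ' : ℕ, ∃ p q : ℝ, 0 < p ∧ 0 < q ∧ q < 1 ∧
            (∀ t, τ' ≤ t →
              ‖bmsSequence g h x (t + 1) - ybar‖ ≤ p * ‖bmsSequence g h x t - ybar‖ ^ 3) ∧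
            (fun t => bmsSequence g h x t - ybar) =O[atTop] (fun t : ℕ => q ^ (3 ^ t)) ∧
            (∀ m, ∀ i ∈ m.supp,
              (fun t => bmsSequence g h x t i - z m) =O[atTop] (fun t : ℕ => q ^ (3 ^ t))) ∧
            (fun t => bmsObjective K h ybar - bmsObjective K h (bmsSequence g h x t))
              =O[atTop] (fun t : ℕ => q ^ (2 * 3 ^ t))) := by
  obtain ⟨c, hw⟩ := exists_isTruncatedWeight hK hg htrunc hh
  obtain ⟨ybar, τ, T, r, hlim, hr, hfar, hτT, hhalf, hdist⟩ :=
    exists_limit_bmsSequence hK hg hh hw x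
  have hg0 := hw.pos
  have hρ := hw.radius_pos
  set D : ℕ → ℝ := fun t => relatedSpread r (fun i => bmsSequence g h x t i) with hD
  have hDnn : ∀ t, 0 ≤ D t := fun t => relatedSpread_nonneg r _
  have hDlim : Tendsto D atTop (𝓝 0) := tendsto_zero_of_halving hDnn hhalf
  have hcoord : ∀ i, Tendsto (fun t => bmsSequence g h x t i) atTop (𝓝 (ybar i)) := fun i =>
    ((by fun_prop : Continuous fun u : Configuration n d => u i).tendsto ybar).comp hlim
  have hcoord' : ∀ i j, Tendsto (fun t => ‖bmsSequence g h x t i - bmsSequence g h x t j‖) atTop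
      (𝓝 ‖ybar i - ybar j‖) := fun i j => ((hcoord i).sub (hcoord j)).norm
  have hbar : ∀ i j, r i j → ybar i = ybar j := fun i j hij => by
    rw [← sub_eq_zero, ← norm_eq_zero]
    exact tendsto_nhds_unique (hcoord' i j) (squeeze_zero (fun _ => norm_nonneg _)
      (fun t => norm_sub_le_relatedSpread (fun i => bmsSequence g h x t i) hij) hDlim)
  have hbar_far : ∀ i j, ¬ r i j → (truncationPoint k).toReal * h ≤ ‖ybar i - ybar j‖ :=
    fun i j hij => ge_of_tendsto (hcoord' i j)
      (eventually_atTop.2 ⟨τ, fun t ht => hfar t ht i j hij⟩)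
  have hadj : ∀ t, τ ≤ t → ∀ i j,
      (bmsGraph g h (bmsSequence g h x t)).Adj i j ↔ i ≠ j ∧ r i j :=
    fun t ht i j => and_congr_right fun _ => hr t ht i j
  have hreach : ∀ i j, (bmsGraph g h (bmsSequence g h x τ)).Reachable i j → r i j := by
    rintro i j ⟨p⟩
    induction p with
    | nil => exact r.refl _
    | cons hadj' _ ih => exact r.trans ((hadj τ le_rfl _ _).1 hadj').2 ih
  have hO_obj : ∀ f : ℕ → ℝ, (fun t => bmsSequence g h x t - ybar) =O[atTop] f →
      (fun t => bmsObjective K h ybar - bmsObjective K h (bmsSequence g h x t))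
        =O[atTop] fun t => f t ^ 2 := by
    intro f hf
    refine IsBigO.trans ?_ (hf.norm_left.pow 2)
    refine IsBigO.of_bound (n * (n * (g 0 * (2 / h ^ 2)))) ?_
    filter_upwards [eventually_ge_atTop τ] with t ht
    rw [Real.norm_eq_abs, Real.norm_of_nonneg (sq_nonneg _)]
    exact abs_bmsObjective_sub_le hK hg hh htrunc.1 hbar (hfar t ht) hbar_far
  have hout : ∀ m : (bmsGraph g h (bmsSequence g h x τ)).ConnectedComponent,
      ∀ i ∈ m.supp, ybar i = ybar (Quot.out m) := by
    intro m i hi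
    refine hbar _ _ (hreach _ _ (SimpleGraph.ConnectedComponent.exact ?_))
    exact ((SimpleGraph.ConnectedComponent.mem_supp_iff m i).1 hi).trans (Quot.out_eq m).symm
  have hO_coord : ∀ f : ℕ → ℝ, (fun t => bmsSequence g h x t - ybar) =O[atTop] f →
      ∀ m : (bmsGraph g h (bmsSequence g h x τ)).ConnectedComponent, ∀ i ∈ m.supp,
        (fun t => bmsSequence g h x t i - ybar (Quot.out m)) =O[atTop] f := by
    intro f hf m i hi
    rw [← hout m i hi]
    exact IsBigO.trans (IsBigO.of_norm_le fun t =>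
      PiLp.norm_apply_le (bmsSequence g h x t - ybar) i) hf.norm_left
  refine ⟨ybar, hlim, τ, ?_, ?_, ?_, fun m => ybar (Quot.out m), ?_, ?_, ?_⟩
  · intro m i hi j hj hij
    exact (hadj τ le_rfl i j).2 ⟨hij, hreach i j (m.reachable_of_mem_supp hi hj)⟩
  · intro t ht
    ext i j
    rw [hadj t ht, hadj τ le_rfl]
  · intro hcrit t ht
    ext i j
    rw [hadj t ht]
    refine and_congr_right fun _ => ?_
    constructor
    · intro hij
      rw [hbar i j hij, hw.self]
      exact hg0.ne'
    · intro hne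
      by_contra hij
      -- Only in the equality case can an edge appear in the limit; both alternatives of the
      -- hypothesis exclude it.
      rcases (hbar_far i j hij).eq_or_lt with heq | hlt
      · rcases hcrit with hcrit | hcrit
        · refine hne ?_
          rw [bmsWeight_eq hh, ← heq, ← hcrit]
          congr 1
          field_simp
        · exact hcrit i j heq.symm
      · exact hne (hw.eq_zero _ _ hlt)
  · intro m m' hmm
    have hrel : r (Quot.out m) (Quot.out m') := by
      by_contra hij
      have := hbar_far _ _ hij
      rw [show ybar (Quot.out m) = ybar (Quot.out m') from hmm, sub_self, norm_zero] at this
      linarith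
    rw [← Quot.out_eq m, ← Quot.out_eq m']
    by_cases he : Quot.out m = Quot.out m'
    · rw [he]
    · exact SimpleGraph.ConnectedComponent.sound
        (SimpleGraph.Adj.reachable ((hadj τ le_rfl _ _).2 ⟨he, hrel⟩))
  · have hO : (fun t => bmsSequence g h x t - ybar) =O[atTop] fun t : ℕ => (3 / 4 : ℝ) ^ t := by
      have h₁ : (fun t => bmsSequence g h x t - ybar) =O[atTop] D := by
        refine IsBigO.of_bound (2 * n) ?_
        filter_upwards [eventually_ge_atTop T] with t ht
        rw [Real.norm_of_nonneg (hDnn t)]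
        exact hdist t ht
      -- Halving gives the rate `1 / 2`, weakened here to `3 / 4` to lie in the stated range.
      refine (h₁.trans (isBigO_half_pow_of_halving hDnn hhalf)).trans
        (IsBigO.of_norm_le fun t => ?_)
      rw [Real.norm_of_nonneg (by positivity)]
      exact pow_le_pow_left₀ (by norm_num) (by norm_num) t
    refine ⟨3 / 4, le_rfl, by norm_num, hO, hO_coord _ hO, ?_⟩
    simpa only [← pow_mul, mul_comm] using hO_obj _ hO
  · intro hl
    obtain ⟨C, hC, hCw⟩ := exists_sub_bmsWeight_le hK hg hh hg0 hl
    have hsmall : ∀ᶠ t in atTop, C * D t ^ 2 < g 0 / 2 := by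
      have := (hDlim.pow 2).const_mul C
      rw [zero_pow two_ne_zero, mul_zero] at this
      exact this.eventually (gt_mem_nhds (by linarith))
    obtain ⟨S, hS⟩ := eventually_atTop.1 hsmall
    -- The weight defect is taken as `ε = C * D t ^ 2`, so the contraction bound becomes cubic in `D
    -- t`.
    have hDcube : ∀ t, max T S ≤ t → D (t + 1) ≤ n ^ 2 * (4 * C / g 0) * D t ^ 3 := by
      intro t ht
      have htτ : τ ≤ t := hτT.trans ((le_max_left _ _).trans ht)
      have h₁ := hw.relatedSpread_step_le (fun i => bmsSequence_succ_apply x t i) (hr t htτ)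
        (mul_nonneg hC.le (sq_nonneg (D t))) (hS t ((le_max_right _ _).trans ht)).le
        fun i j hij => by
          refine le_trans (sub_le_sub_left (mul_le_mul_of_nonneg_left (pow_le_pow_left₀
            (norm_nonneg _) ?_ 2) hC.le) _) (hCw _ _)
          exact norm_sub_le_relatedSpread (fun i => bmsSequence g h x t i) hij
      rw [Fintype.card_fin] at h₁
      refine h₁.trans (le_of_eq ?_)
      change (n : ℝ) ^ 2 * (4 * (C * D t ^ 2) / g 0 * D t) = _
      ring
    -- The `+ 1` keeps `p` positive when `n = 0`.
    set p : ℝ := 2 * n * (n ^ 2 * (4 * C / g 0)) * (2 * n ^ 2) ^ 3 + 1 with hp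
    have hppos : 0 < p := by positivity
    have hcube : ∀ t, max T S ≤ t →
        ‖bmsSequence g h x (t + 1) - ybar‖ ≤ p * ‖bmsSequence g h x t - ybar‖ ^ 3 := by
      intro t ht
      have htT : T ≤ t := (le_max_left _ _).trans ht
      have h₁ := hdist (t + 1) (htT.trans t.le_succ)
      have h₂ : D t ≤ 2 * n ^ 2 * ‖bmsSequence g h x t - ybar‖ := relatedSpread_le_norm_sub hbar
      calc ‖bmsSequence g h x (t + 1) - ybar‖ ≤ 2 * n * D (t + 1) := h₁
        _ ≤ 2 * n * (n ^ 2 * (4 * C / g 0) * D t ^ 3) := by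
          gcongr
          exact hDcube t ht
        _ ≤ 2 * n * (n ^ 2 * (4 * C / g 0) *
              (2 * n ^ 2 * ‖bmsSequence g h x t - ybar‖) ^ 3) := by
          have := pow_le_pow_left₀ (hDnn t) h₂ 3
          gcongr
        _ ≤ p * ‖bmsSequence g h x t - ybar‖ ^ 3 := by
          have : 0 ≤ ‖bmsSequence g h x t - ybar‖ ^ 3 := by positivity
          rw [hp, add_mul, one_mul, mul_pow]
          linarith
    have hlim0 : Tendsto (fun t => ‖bmsSequence g h x t - ybar‖) atTop (𝓝 0) :=
      tendsto_iff_norm_sub_tendsto_zero.1 hlim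
    obtain ⟨q, hq0, hq1, hqO⟩ :=
      exists_isBigO_pow_three_pow hppos (fun _ => norm_nonneg _) hlim0 hcube
    have hO := hqO.of_norm_left
    refine ⟨max T S, p, q, hppos, hq0, hq1, hcube, hO, hO_coord _ hO, ?_⟩
    simpa only [← pow_mul, mul_comm] using hO_obj _ hO
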